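/- Let $R$ be a principal ideal domain. Let $X$ be a Hausdorff space with a filtration $X_0\subseteq X_1\subseteq\dots\subseteq X_n=X$ by closed subspaces such that $X_n\setminus X_{n-1}\neq\emptyset$ (put $X_{-1}=\emptyset$). The strata of $X$ are the connected components $S$ of the sets $X_i\setminus X_{i-1}$, with $\dim S=i$ and $\operatorname{codim} S=n-i$; those of codimension $0$ are called regular. Let $\overline p$ be a perversity on $X$, i.e. a map from the set of strata to $\mathbb Z$ that vanishes on the regular strata. A singular simplex $\sigma\colon\Delta\to X$ is filtered if each $\sigma^{-1}(X_i)$ is a (possibly empty) face of $\Delta$; write $\Delta=\Delta_0*\dots*\Delta_n$ with $\sigma^{-1}(X_i)=\Delta_0*\dots*\Delta_i$. It is regular if $\Delta_n\neq\emptyset$, and $\overline p$-allowable if $\dim(\Delta_0*\dots*\Delta_{n-\operatorname{codim}S})\le\dim\Delta-\operatorname{codim}S+\overline p(S)$ for every stratum $S$ that meets $\sigma(\Delta)$. For a regular simplex $\sigma$ let $\mathfrak d\sigma$ be the part of $\partial\sigma$ supported on regular simplices. A formal sum of regular simplices with coefficients in $R$ is locally finite if every point of $X$ has a neighbourhood that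 meets only finitely many simplices of the sum; $\mathfrak d$ extends to such sums. A tame $\overline p$-intersection chain is a formal sum $\xi$ of regular simplices such that all simplices of $\xi$ and of $\mathfrak d\xi$ are $\overline p$-allowable. With the differential $\mathfrak d$, the finite tame $\overline p$-intersection chains form a complex $\mathfrak C^{\overline p}_*(X;R)$ and the locally finite ones a complex $\mathfrak C^{\mathrm{BM},\overline p}_*(X;R)$. For $U\subseteq X$ open, with the induced filtration and perversity, put $\mathfrak C^{\overline p}_*(X,U;R)=\mathfrak C^{\overline p}_*(X;R)/\mathfrak C^{\overline p}_*(U;R)$. Suppose that $X$ is locally compact, metrizable and separable. Then there is an isomorphism of chain complexes of $R$-modules $$\mathfrak C^{\mathrm{BM},\overline p}_*(X;R)\;\xrightarrow{\ \cong\ }\;\varprojlim_{K\subseteq X}\mathfrak C^{\overline p}_*(X,X\setminus K;R),$$ where the limit is taken over all compact subsets $K$ of $X$, ordered by inclusion. More precisely, the isomorphism can be chosen such that, for every locally finite chain $c$ and every compact $K$, the component at $K$ of the image of $c$ is the class of a finite tame $\overline p$-intersection chain $d$ whose coefficients agree with those of $c$ on all simplices that meet $K$. -/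

import Mathlib

open CategoryTheory CategoryTheory.Limits TopologicalSpace Topology Opposite

universe u v

noncomputable section

namespace Perv

/-! ### Filtered spaces, strata, perversities -/

/-- An increasing filtration `X₀ ⊆ X₁ ⊆ ⋯ ⊆ Xₙ = X` of a topological space by closed subspaces.
The Hausdorff property and the non-emptiness of `Xₙ \ Xₙ₋₁` are separate hypotheses on `X`; an open
subset of a space always inherits such a filtration, possibly without regular part. -/
structure ClosedFiltration (X : Type u) [TopologicalSpace X] (n : ℕ) where
  level : Fin (n + 1) → Set X
  isClosed_level : ∀ i, IsClosed (level i)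
  monotone_level : Monotone level
  level_last : level (Fin.last n) = Set.univ

variable {X : Type u} [TopologicalSpace X] {n : ℕ}

namespace ClosedFiltration

variable (F : ClosedFiltration X n)

/-- The difference `Xᵢ \ Xᵢ₋₁` (with `X₋₁ = ∅`). -/
def layer (i : Fin (n + 1)) : Set X := F.level i \ ⋃ j < i, F.level j

/-- The regular part `Xₙ \ Xₙ₋₁`. -/
def regularPart : Set X := F.layer (Fin.last n)

/-- The strata: the connected components of the differences `Xᵢ \ Xᵢ₋₁`. -/
def Stratum : Type u := Σ i : Fin (n + 1), ConnectedComponents (F.layer i)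

end ClosedFiltration

namespace ClosedFiltration.Stratum

variable {F : ClosedFiltration X n}

/-- The dimension `d(S) = i` of a component `S` of `Xᵢ \ Xᵢ₋₁`. -/
def dim (S : F.Stratum) : Fin (n + 1) := S.1

/-- The codimension `n - d(S)`. -/
def codim (S : F.Stratum) : Fin (n + 1) := S.dim.rev

/-- The stratum as a subset of `X`. -/
def carrier (S : F.Stratum) : Set X :=
  {x | ∃ h : x ∈ F.layer S.1, ConnectedComponents.mk (⟨x, h⟩ : F.layer S.1) = S.2}

end ClosedFiltration.Stratum

/-- A perversity: an integer for every stratum, equal to `0` on the regular strata. -/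
structure Perversity (F : ClosedFiltration X n) where
  toFun : F.Stratum → ℤ
  regular_eq_zero : ∀ S : F.Stratum, S.dim = Fin.last n → toFun S = 0

/-! ### Open subspaces -/

/-- The induced filtration `Uᵢ = U ∩ Xᵢ` of an open subset `U`. -/
def ClosedFiltration.restrict (F : ClosedFiltration X n) (U : Opens X) :
    ClosedFiltration U n where
  level i := Subtype.val ⁻¹' F.level i
  isClosed_level i := (F.isClosed_level i).preimage continuous_subtype_val
  monotone_level _ _ h := Set.preimage_mono (F.monotone_level h)
  level_last := by rw [F.level_last, Set.preimage_univ]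

theorem ClosedFiltration.mem_restrict_layer (F : ClosedFiltration X n) (U : Opens X)
    (i : Fin (n + 1)) (x : U) : x ∈ (F.restrict U).layer i ↔ (x : X) ∈ F.layer i := by
  simp [ClosedFiltration.layer, ClosedFiltration.restrict]

/-- The inclusion `Uᵢ \ Uᵢ₋₁ → Xᵢ \ Xᵢ₋₁`. -/
def ClosedFiltration.layerMap (F : ClosedFiltration X n) (U : Opens X) (i : Fin (n + 1)) :
    (F.restrict U).layer i → F.layer i :=
  fun x => ⟨x.1.1, (F.mem_restrict_layer U i x.1).1 x.2⟩

theorem ClosedFiltration.continuous_layerMap (F : ClosedFiltration X n) (U : Opens X)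
    (i : Fin (n + 1)) : Continuous (F.layerMap U i) :=
  Continuous.subtype_mk (continuous_subtype_val.comp continuous_subtype_val) _

/-- The stratum of `X` that contains a given stratum of the open subset `U`. -/
def ClosedFiltration.stratumMap (F : ClosedFiltration X n) (U : Opens X)
    (S : (F.restrict U).Stratum) : F.Stratum :=
  ⟨S.1, (F.continuous_layerMap U S.1).connectedComponentsMap S.2⟩

/-- The perversity induced on an open subset: the pull-back along the inclusion. -/
def Perversity.restrict {F : ClosedFiltration X n} (p : Perversity F) (U : Opens X) :
    Perversity (F.restrict U) where
  toFun S := p.toFun (F.stratumMap U S)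
  regular_eq_zero _ h := p.regular_eq_zero _ h

/-! ### Filtered and regular simplices -/

/-- The standard simplex of dimension `k`. -/
abbrev Simp (k : ℕ) : Type := stdSimplex ℝ (Fin (k + 1))

/-- The face of the standard simplex spanned by a set of vertices (empty for the empty set). -/
def faceSet {k : ℕ} (A : Finset (Fin (k + 1))) : Set (Simp k) := {x | ∀ j, j ∉ A → x j = 0}

/-- The inclusion of the `i`-th codimension one face. -/
def faceMap {k : ℕ} (i : Fin (k + 2)) : C(Simp k, Simp (k + 1)) :=
  ⟨stdSimplex.map i.succAbove, stdSimplex.continuous_map _⟩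

/-- A filtered simplex: a singular simplex `σ : Δ → X` such that each `σ⁻¹(Xᵢ)` is a face of `Δ`. -/
@[ext]
structure FilteredSimplex (F : ClosedFiltration X n) (k : ℕ) where
  toMap : C(Simp k, X)
  isFace : ∀ i, ∃ A : Finset (Fin (k + 1)), toMap ⁻¹' F.level i = faceSet A

namespace FilteredSimplex

variable {F : ClosedFiltration X n} {k : ℕ}

/-- With `Δ = Δ₀ * ⋯ * Δₙ` the join decomposition of a filtered simplex `σ`, i.e.
`Δ₀ * ⋯ * Δᵢ = σ⁻¹(Xᵢ)`, the set of the vertices of `Δ₀ * ⋯ * Δᵢ`. -/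
def joinVertices (σ : FilteredSimplex F k) (i : Fin (n + 1)) : Finset (Fin (k + 1)) :=
  open Classical in Finset.univ.filter fun j => σ.toMap (stdSimplex.vertex j) ∈ F.level i

/-- The simplex is regular: `Δₙ ≠ ∅`, i.e. some vertex lies in the regular part. -/
def IsRegular (σ : FilteredSimplex F k) : Prop :=
  ∃ j, σ.toMap (stdSimplex.vertex j) ∈ F.regularPart

/-- The dimension of the face with the given set of vertices, `-∞` for the empty face. -/
def faceDim (A : Finset (Fin (k + 1))) : WithBot ℤ :=
  if A = ∅ then ⊥ else (((A.card : ℤ) - 1 : ℤ) : WithBot ℤ)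

/-- The perverse degree `‖σ‖ᵢ = dim (Δ₀ * ⋯ * Δₙ₋ᵢ)`. -/
def perverseDegree (σ : FilteredSimplex F k) (i : Fin (n + 1)) : WithBot ℤ :=
  faceDim (σ.joinVertices i.rev)

/-- The perverse degree of `σ` along a stratum `S`: it is `-∞` if `S` does not meet the image of
`σ` and `‖σ‖_{codim S}` otherwise. -/
def perverseDegreeAlong (σ : FilteredSimplex F k) (S : F.Stratum) : WithBot ℤ :=
  open Classical in
  if S.carrier ∩ Set.range σ.toMap = ∅ then ⊥ else σ.perverseDegree S.codim

/-- `σ` is `p`-allowable: `‖σ‖_S ≤ dim Δ - codim S + p(S)` for every stratum `S`. -/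
def IsAllowable (p : Perversity F) (σ : FilteredSimplex F k) : Prop :=
  ∀ S : F.Stratum,
    σ.perverseDegreeAlong S ≤ (((k : ℤ) - ((S.codim : ℕ) : ℤ) + p.toFun S : ℤ) : WithBot ℤ)

end FilteredSimplex

/-- The regular simplices of dimension `k`. -/
@[ext]
structure RegularSimplex (F : ClosedFiltration X n) (k : ℕ) extends FilteredSimplex F k where
  isRegular : toFilteredSimplex.IsRegular

/-! ### Chains and the differential -/

variable {F : ClosedFiltration X n}

/-- The coefficient of the regular simplex `τ` in the regular part `𝔡σ` of `∂σ`. -/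
def incidence {k : ℕ} (σ : RegularSimplex F (k + 1)) (τ : RegularSimplex F k) : ℤ :=
  open Classical in
  ∑ i : Fin (k + 2), if τ.toMap = σ.toMap.comp (faceMap i) then (-1 : ℤ) ^ (i : ℕ) else 0

/-- A formal sum `∑ ξ(σ) σ` of regular simplices is locally finite: every point of `X` has a
neighbourhood that meets only finitely many simplices of the sum. -/
def IsLocallyFinite {R : Type v} [CommRing R] {k : ℕ} (ξ : RegularSimplex F k → R) : Prop :=
  ∀ x : X, ∃ V ∈ 𝓝 x, {σ | ξ σ ≠ 0 ∧ (Set.range σ.toMap ∩ V).Nonempty}.Finite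

/-- The differential `𝔡` on formal sums of regular simplices: the coefficient of `τ` in `𝔡ξ` is
the sum of the coefficients of `τ` in the `ξ(σ) 𝔡σ`. The sum has finitely many non-zero terms if
`ξ` is locally finite, see `finite_incidence`. -/
def boundary {R : Type v} [CommRing R] {k : ℕ} (ξ : RegularSimplex F (k + 1) → R) :
    RegularSimplex F k → R :=
  fun τ => ∑ᶠ σ, incidence σ τ • ξ σ

section differential

variable {R : Type v} [CommRing R] {k : ℕ}

theorem exists_face_of_incidence {σ : RegularSimplex F (k + 1)} {τ : RegularSimplex F k}
    (h : incidence σ τ ≠ 0) : ∃ i, τ.toMap = σ.toMap.comp (faceMap i) := by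
  by_contra! hc
  exact h (Finset.sum_eq_zero fun i _ => if_neg (hc i))

theorem range_subset_of_incidence {σ : RegularSimplex F (k + 1)} {τ : RegularSimplex F k}
    (h : incidence σ τ ≠ 0) : Set.range τ.toMap ⊆ Set.range σ.toMap := by
  obtain ⟨i, hi⟩ := exists_face_of_incidence h
  rintro _ ⟨t, rfl⟩
  exact ⟨faceMap i t, by rw [hi]; rfl⟩

/-- Only finitely many simplices of a locally finite sum meet a given compact set. -/
theorem IsLocallyFinite.finite_meet {ξ : RegularSimplex F k → R} (h : IsLocallyFinite ξ)
    {K : Set X} (hK : IsCompact K) :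
    {σ | ξ σ ≠ 0 ∧ (Set.range σ.toMap ∩ K).Nonempty}.Finite := by
  choose V hV hfin using h
  obtain ⟨t, -, ht⟩ := hK.elim_nhds_subcover V fun x _ => hV x
  refine (t.finite_toSet.biUnion fun x _ => hfin x).subset ?_
  rintro σ ⟨h0, y, hy, hyK⟩
  obtain ⟨x, hx, hxy⟩ := Set.mem_iUnion₂.1 (ht hyK)
  exact Set.mem_biUnion (Finset.mem_coe.2 hx) ⟨h0, y, hy, hxy⟩

theorem IsLocallyFinite.of_finite {ξ : RegularSimplex F k → R} (h : {σ | ξ σ ≠ 0}.Finite) :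
    IsLocallyFinite ξ :=
  fun _ => ⟨Set.univ, Filter.univ_mem, h.subset fun _ hσ => hσ.1⟩

theorem IsLocallyFinite.finite_meet_simplex {l : ℕ} {ξ : RegularSimplex F k → R}
    (h : IsLocallyFinite ξ) (τ : RegularSimplex F l) :
    {σ | ξ σ ≠ 0 ∧ (Set.range σ.toMap ∩ Set.range τ.toMap).Nonempty}.Finite :=
  h.finite_meet (isCompact_range τ.toMap.continuous)

theorem meet_of_incidence {σ : RegularSimplex F (k + 1)} {τ : RegularSimplex F k}
    (h : incidence σ τ ≠ 0) : (Set.range σ.toMap ∩ Set.range τ.toMap).Nonempty := by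
  rw [Set.inter_eq_self_of_subset_right (range_subset_of_incidence h)]
  exact Set.range_nonempty _

theorem finite_incidence {ξ : RegularSimplex F (k + 1) → R} (h : IsLocallyFinite ξ)
    (τ : RegularSimplex F k) : (Function.support fun σ => incidence σ τ • ξ σ).Finite := by
  refine (h.finite_meet_simplex τ).subset fun σ hσ => ?_
  have h1 : incidence σ τ ≠ 0 := fun h0 => hσ (by simp [h0])
  exact ⟨fun h0 => hσ (by simp [h0]), meet_of_incidence h1⟩

theorem boundary_add {ξ η : RegularSimplex F (k + 1) → R} (hξ : IsLocallyFinite ξ)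
    (hη : IsLocallyFinite η) : boundary (ξ + η) = boundary ξ + boundary η := by
  funext τ
  simp only [boundary, Pi.add_apply, smul_add]
  exact finsum_add_distrib (finite_incidence hξ τ) (finite_incidence hη τ)

theorem boundary_smul (r : R) {ξ : RegularSimplex F (k + 1) → R} (hξ : IsLocallyFinite ξ) :
    boundary (r • ξ) = r • boundary ξ := by
  funext τ
  simp only [boundary, Pi.smul_apply]
  rw [smul_finsum' r (finite_incidence hξ τ)]
  exact finsum_congr fun σ => smul_comm _ _ _

theorem boundary_zero : boundary (0 : RegularSimplex F (k + 1) → R) = 0 := by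
  funext τ
  simp [boundary]

/-- A simplex of `𝔡ξ` is a face of a simplex of `ξ`. -/
theorem exists_of_boundary_ne_zero {ξ : RegularSimplex F (k + 1) → R} {τ : RegularSimplex F k}
    (h : boundary ξ τ ≠ 0) : ∃ σ, ξ σ ≠ 0 ∧ incidence σ τ ≠ 0 := by
  by_contra! hc
  refine h ((finsum_congr fun σ => ?_).trans finsum_zero)
  by_cases h0 : ξ σ = 0
  · rw [h0, smul_zero]
  · rw [hc σ h0, zero_smul]

theorem finite_faces (σ : RegularSimplex F (k + 1)) :
    {τ : RegularSimplex F k | ∃ i, τ.toMap = σ.toMap.comp (faceMap i)}.Finite := by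
  have hinj : Function.Injective fun τ : RegularSimplex F k => τ.toMap := fun a b h =>
    RegularSimplex.ext h
  refine Set.Finite.subset ((Set.finite_range fun i : Fin (k + 2) =>
    σ.toMap.comp (faceMap i)).preimage hinj.injOn) fun τ hτ => ?_
  obtain ⟨i, hi⟩ := hτ
  exact ⟨i, hi.symm⟩

theorem finite_boundary {ξ : RegularSimplex F (k + 1) → R} {T : Set (RegularSimplex F (k + 1))}
    (hT : T.Finite) : {τ | ∃ σ ∈ T, ξ σ ≠ 0 ∧ incidence σ τ ≠ 0}.Finite := by
  refine (hT.biUnion fun σ _ => finite_faces σ).subset ?_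
  rintro τ ⟨σ, hσ, -, h⟩
  exact Set.mem_biUnion hσ (exists_face_of_incidence h)

theorem IsLocallyFinite.boundary {ξ : RegularSimplex F (k + 1) → R} (h : IsLocallyFinite ξ) :
    IsLocallyFinite (boundary ξ) := by
  intro x
  obtain ⟨V, hV, hfin⟩ := h x
  refine ⟨V, hV, (finite_boundary (ξ := ξ) hfin).subset ?_⟩
  rintro τ ⟨h0, hm⟩
  obtain ⟨σ, h1, h2⟩ := exists_of_boundary_ne_zero h0
  exact ⟨σ, ⟨h1, hm.mono (Set.inter_subset_inter_left _ (range_subset_of_incidence h2))⟩, h1, h2⟩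

theorem finite_support_boundary {ξ : RegularSimplex F (k + 1) → R} (h : {σ | ξ σ ≠ 0}.Finite) :
    {τ | Perv.boundary ξ τ ≠ 0}.Finite := by
  refine (finite_boundary (ξ := ξ) h).subset fun τ hτ => ?_
  obtain ⟨σ, h1, h2⟩ := exists_of_boundary_ne_zero hτ
  exact ⟨σ, h1, h1, h2⟩

theorem faceMap_apply_succAbove (i : Fin (k + 2)) (x : Simp k) (l : Fin (k + 1)) :
    faceMap i x (i.succAbove l) = x l := by
  change stdSimplex.map i.succAbove x (i.succAbove l) = x l
  rw [stdSimplex.map_coe, FunOnFinite.linearMap_apply_apply]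
  rw [Finset.sum_eq_single l]
  · intro b hb hne
    exact absurd (Fin.succAbove_right_injective (Finset.mem_filter.1 hb).2) hne
  · simp

theorem faceMap_apply_self (i : Fin (k + 2)) (x : Simp k) : faceMap i x i = 0 := by
  change stdSimplex.map i.succAbove x i = 0
  rw [stdSimplex.map_coe, FunOnFinite.linearMap_apply_apply]
  refine Finset.sum_eq_zero fun b hb => ?_
  exact absurd (Finset.mem_filter.1 hb).2 (Fin.succAbove_ne i b)

/-- A codimension one face of a filtered simplex is a filtered simplex. -/
def FilteredSimplex.face (σ : FilteredSimplex F (k + 1)) (i : Fin (k + 2)) :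
    FilteredSimplex F k where
  toMap := σ.toMap.comp (faceMap i)
  isFace m := by
    classical
    obtain ⟨A, hA⟩ := σ.isFace m
    refine ⟨Finset.univ.filter fun l => i.succAbove l ∈ A, ?_⟩
    have h1 : (σ.toMap.comp (faceMap i)) ⁻¹' F.level m = faceMap i ⁻¹' faceSet A := by
      rw [← hA]; rfl
    rw [h1]
    ext x
    simp only [faceSet, Set.mem_preimage, Set.mem_ofPred_eq, Finset.mem_filter, Finset.mem_univ,
      true_and]
    constructor
    · intro h l hl
      rw [← faceMap_apply_succAbove i x l]
      exact h _ hl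
    · intro h j hj
      rcases Fin.eq_self_or_eq_succAbove i j with rfl | ⟨l, rfl⟩
      · exact faceMap_apply_self _ _
      · rw [faceMap_apply_succAbove]
        exact h l hj

theorem FilteredSimplex.isRegular_of_face {σ : FilteredSimplex F (k + 1)}
    {τ : FilteredSimplex F k} {i : Fin (k + 2)} (h : τ.toMap = σ.toMap.comp (faceMap i))
    (hτ : τ.IsRegular) : σ.IsRegular := by
  obtain ⟨j, hj⟩ := hτ
  refine ⟨i.succAbove j, ?_⟩
  rw [h] at hj
  have : faceMap i (stdSimplex.vertex j) = stdSimplex.vertex (i.succAbove j) :=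
    stdSimplex.map_vertex _ _
  rw [← this]
  exact hj

theorem faceMap_comp_faceMap {i j : Fin (k + 2)} (h : i ≤ j) :
    (faceMap i.castSucc).comp (faceMap j) = (faceMap j.succ).comp (faceMap (k := k) i) := by
  ext1 x
  change stdSimplex.map _ (stdSimplex.map _ x) = stdSimplex.map _ (stdSimplex.map _ x)
  rw [stdSimplex.map_comp_apply, stdSimplex.map_comp_apply]
  congr 1
  have := SimplexCategory.δ_comp_δ h
  funext l
  exact (congrArg (fun f => SimplexCategory.Hom.toOrderHom f l) this).symm

theorem sum_faces_faces (f : C(Simp (k + 2), X)) (g : C(Simp k, X)) :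
    (open Classical in ∑ i : Fin (k + 3), ∑ j : Fin (k + 2),
      if g = (f.comp (faceMap i)).comp (faceMap j) then (-1 : ℤ) ^ (i : ℕ) * (-1) ^ (j : ℕ)
      else 0) = 0 := by
  classical
  rw [← Finset.sum_product', Finset.univ_product_univ]
  let φ : Fin (k + 3) × Fin (k + 2) → Fin (k + 3) × Fin (k + 2) := fun a =>
    if h : (a.1 : ℕ) ≤ a.2 then (a.2.succ, ⟨a.1, by omega⟩)
    else (a.2.castSucc, ⟨a.1 - 1, by omega⟩)
  refine Finset.sum_involution (fun a _ => φ a) ?_ ?_ (fun _ _ => Finset.mem_univ _) ?_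
  · rintro ⟨i, j⟩ -
    by_cases h : (i : ℕ) ≤ j
    · have hφ : φ (i, j) = (j.succ, ⟨i, by omega⟩) := dif_pos h
      have hc := faceMap_comp_faceMap (k := k) (i := ⟨i, by omega⟩) (j := j) h
      have hi : Fin.castSucc (⟨i, by omega⟩ : Fin (k + 2)) = i := rfl
      rw [hi] at hc
      rw [hφ]
      simp only [ContinuousMap.comp_assoc, hc, Fin.val_succ]
      split_ifs
      · ring
      · ring
    · have hφ : φ (i, j) = (j.castSucc, ⟨i - 1, by omega⟩) := dif_neg h
      have hc := faceMap_comp_faceMap (k := k) (i := j) (j := ⟨i - 1, by omega⟩)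
        (Fin.le_def.2 (by simp only; omega))
      have hi : Fin.succ (⟨i - 1, by omega⟩ : Fin (k + 2)) = i :=
        Fin.ext (by simp only [Fin.val_succ]; omega)
      rw [hi] at hc
      rw [hφ]
      simp only [ContinuousMap.comp_assoc, hc, Fin.val_castSucc]
      have hpow : (-1 : ℤ) ^ (i : ℕ) = (-1) ^ ((i : ℕ) - 1) * (-1) := by
        rw [← pow_succ]; congr 1; omega
      rw [hpow]
      split_ifs
      · ring
      · ring
  · rintro ⟨i, j⟩ - - heq
    have h1 := congrArg (fun a => (a.1 : ℕ)) heq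
    by_cases h : (i : ℕ) ≤ j
    · have hφ : φ (i, j) = (j.succ, ⟨i, by omega⟩) := dif_pos h
      rw [hφ] at h1
      simp only [Fin.val_succ] at h1
      omega
    · have hφ : φ (i, j) = (j.castSucc, ⟨i - 1, by omega⟩) := dif_neg h
      rw [hφ] at h1
      simp only [Fin.val_castSucc] at h1
      omega
  · rintro ⟨i, j⟩ -
    by_cases h : (i : ℕ) ≤ j
    · have hφ : φ (i, j) = (j.succ, ⟨i, by omega⟩) := dif_pos h
      simp only [hφ]
      have : ¬ ((j.succ : ℕ) ≤ i) := by simp only [Fin.val_succ]; omega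
      refine (dif_neg this).trans ?_
      simp
    · have hφ : φ (i, j) = (j.castSucc, ⟨i - 1, by omega⟩) := dif_neg h
      simp only [hφ]
      have : (j.castSucc : ℕ) ≤ i - 1 := by simp only [Fin.val_castSucc]; omega
      refine (dif_pos this).trans ?_
      refine Prod.ext (Fin.ext ?_) (Fin.ext ?_)
      · simp only [Fin.val_succ]; omega
      · simp

theorem sum_incidence (σ : RegularSimplex F (k + 2)) (τ : RegularSimplex F k)
    (P : Finset (RegularSimplex F (k + 1)))
    (hP : ∀ (ρ : RegularSimplex F (k + 1)) (i : Fin (k + 3)),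
      ρ.toMap = σ.toMap.comp (faceMap i) → ρ ∈ P) :
    ∑ ρ ∈ P, incidence ρ τ * incidence σ ρ = 0 := by
  classical
  rw [← sum_faces_faces σ.toMap τ.toMap]
  simp only [incidence, Finset.sum_mul_sum]
  rw [Finset.sum_congr rfl fun ρ _ => Finset.sum_comm, Finset.sum_comm]
  refine Finset.sum_congr rfl fun i _ => ?_
  rw [Finset.sum_comm]
  refine Finset.sum_congr rfl fun j _ => ?_
  by_cases h : τ.toMap = (σ.toMap.comp (faceMap i)).comp (faceMap j)
  · rw [if_pos h]
    let ρ : RegularSimplex F (k + 1) :=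
      { σ.toFilteredSimplex.face i with
        isRegular := FilteredSimplex.isRegular_of_face (σ := σ.toFilteredSimplex.face i) h
          τ.isRegular }
    have hρ : ρ.toMap = σ.toMap.comp (faceMap i) := rfl
    rw [Finset.sum_eq_single ρ]
    · rw [if_pos hρ, if_pos (by rw [hρ]; exact h), mul_comm]
    · intro ρ' _ hne
      rw [if_neg (c := ρ'.toMap = _), mul_zero]
      exact fun h' => hne (RegularSimplex.ext (h'.trans hρ.symm))
    · intro hn
      exact absurd (hP ρ i hρ) hn
  · rw [if_neg h]
    refine Finset.sum_eq_zero fun ρ _ => ?_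
    by_cases h1 : ρ.toMap = σ.toMap.comp (faceMap i)
    · rw [h1, if_neg h, zero_mul]
    · rw [if_neg h1, mul_zero]

theorem boundary_boundary {ξ : RegularSimplex F (k + 2) → R} (h : IsLocallyFinite ξ) :
    Perv.boundary (Perv.boundary ξ) = 0 := by
  classical
  funext τ
  have hT := h.finite_meet_simplex τ
  set T := hT.toFinset with hTdef
  have hPfin := hT.biUnion fun σ _ => finite_faces σ
  set P := hPfin.toFinset with hPdef
  have key : ∀ ρ : RegularSimplex F (k + 1), incidence ρ τ ≠ 0 →
      Perv.boundary ξ ρ = ∑ σ ∈ T, incidence σ ρ • ξ σ := by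
    intro ρ hρ
    refine finsum_eq_sum_of_support_subset _ fun σ hσ => ?_
    have h1 : incidence σ ρ ≠ 0 := fun h0 => hσ (by simp [h0])
    rw [hTdef, Set.Finite.coe_toFinset]
    refine ⟨fun h0 => hσ (by simp [h0]), ?_⟩
    rw [Set.inter_eq_self_of_subset_right
      ((range_subset_of_incidence hρ).trans (range_subset_of_incidence h1))]
    exact Set.range_nonempty _
  have h2 : Perv.boundary (Perv.boundary ξ) τ
      = ∑ ρ ∈ P, incidence ρ τ • Perv.boundary ξ ρ := by
    refine finsum_eq_sum_of_support_subset _ fun ρ hρ => ?_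
    have h1 : incidence ρ τ ≠ 0 := fun h0 => hρ (by simp [h0])
    have h3 : Perv.boundary ξ ρ ≠ 0 := fun h0 => hρ (by simp [h0])
    rw [key ρ h1] at h3
    obtain ⟨σ, hσ, h4⟩ := Finset.exists_ne_zero_of_sum_ne_zero h3
    have h5 : incidence σ ρ ≠ 0 := fun h0 => h4 (by simp [h0])
    rw [hPdef, Set.Finite.coe_toFinset]
    exact Set.mem_biUnion (hT.mem_toFinset.1 hσ) (exists_face_of_incidence h5)
  have h6 : ∀ ρ, incidence ρ τ • Perv.boundary ξ ρ
      = ∑ σ ∈ T, (incidence ρ τ * incidence σ ρ) • ξ σ := by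
    intro ρ
    by_cases h0 : incidence ρ τ = 0
    · simp [h0]
    · rw [key ρ h0, Finset.smul_sum]
      exact Finset.sum_congr rfl fun σ _ => smul_smul _ _ _
  rw [h2, Finset.sum_congr rfl fun ρ _ => h6 ρ, Finset.sum_comm]
  refine Finset.sum_eq_zero fun σ hσ => ?_
  rw [← Finset.sum_smul, sum_incidence σ τ P, zero_smul]
  intro ρ i hρ
  rw [hPdef, Set.Finite.mem_toFinset]
  exact Set.mem_biUnion (hT.mem_toFinset.1 hσ) ⟨i, hρ⟩

end differential

/-! ### Tame intersection chains -/

variable {R : Type v} [CommRing R]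

/-- A formal sum of regular simplices is `p`-tame if all its simplices are `p`-allowable. -/
def IsTame (p : Perversity F) {k : ℕ} (ξ : RegularSimplex F k → R) : Prop :=
  ∀ σ, ξ σ ≠ 0 → σ.IsAllowable p

/-- `ξ` and `𝔡ξ` are `p`-tame (where `𝔡ξ = 0` in degree `0`). -/
def IsTameIntersection (p : Perversity F) : {k : ℕ} → (RegularSimplex F k → R) → Prop
  | 0, ξ => IsTame p ξ
  | _ + 1, ξ => IsTame p ξ ∧ IsTame p (boundary ξ)

section closure

variable {p : Perversity F} {k : ℕ}

theorem IsTame.zero : IsTame p (0 : RegularSimplex F k → R) := fun _ h => absurd rfl h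

theorem IsTame.add {ξ η : RegularSimplex F k → R} (h : IsTame p ξ) (h' : IsTame p η) :
    IsTame p (ξ + η) := by
  intro σ hσ
  by_cases h0 : ξ σ = 0
  · exact h' σ fun h1 => hσ (by simp [h0, h1])
  · exact h σ h0

theorem IsTame.smul (r : R) {ξ : RegularSimplex F k → R} (h : IsTame p ξ) :
    IsTame p (r • ξ) :=
  fun σ hσ => h σ fun h0 => hσ (by simp [h0])

theorem IsTameIntersection.isTame {ξ : RegularSimplex F k → R} (h : IsTameIntersection p ξ) :
    IsTame p ξ := by
  cases k with
  | zero => exact h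
  | succ k => exact h.1

theorem IsTameIntersection.zero : IsTameIntersection p (0 : RegularSimplex F k → R) := by
  cases k with
  | zero => exact IsTame.zero
  | succ k => exact ⟨IsTame.zero, by rw [boundary_zero]; exact IsTame.zero⟩

theorem IsTameIntersection.add {ξ η : RegularSimplex F k → R} (hξ : IsLocallyFinite ξ)
    (hη : IsLocallyFinite η) (h : IsTameIntersection p ξ) (h' : IsTameIntersection p η) :
    IsTameIntersection p (ξ + η) := by
  cases k with
  | zero => exact IsTame.add h h'
  | succ k => exact ⟨h.1.add h'.1, by rw [boundary_add hξ hη]; exact h.2.add h'.2⟩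

theorem IsTameIntersection.smul (r : R) {ξ : RegularSimplex F k → R} (hξ : IsLocallyFinite ξ)
    (h : IsTameIntersection p ξ) : IsTameIntersection p (r • ξ) := by
  cases k with
  | zero => exact IsTame.smul r h
  | succ k => exact ⟨h.1.smul r, by rw [boundary_smul r hξ]; exact h.2.smul r⟩

theorem IsTameIntersection.boundary {ξ : RegularSimplex F (k + 1) → R} (hξ : IsLocallyFinite ξ)
    (h : IsTameIntersection p ξ) : IsTameIntersection p (boundary ξ) := by
  cases k with
  | zero => exact h.2
  | succ k => exact ⟨h.2, by rw [boundary_boundary hξ]; exact IsTame.zero⟩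

theorem IsLocallyFinite.add {ξ η : RegularSimplex F k → R} (h : IsLocallyFinite ξ)
    (h' : IsLocallyFinite η) : IsLocallyFinite (ξ + η) := by
  intro x
  obtain ⟨V, hV, hf⟩ := h x
  obtain ⟨W, hW, hg⟩ := h' x
  refine ⟨V ∩ W, Filter.inter_mem hV hW, (hf.union hg).subset ?_⟩
  rintro σ ⟨h0, y, hy, hyV, hyW⟩
  by_cases h1 : ξ σ = 0
  · exact Or.inr ⟨fun h2 => h0 (by simp [h1, h2]), y, hy, hyW⟩
  · exact Or.inl ⟨h1, y, hy, hyV⟩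

theorem IsLocallyFinite.smul (r : R) {ξ : RegularSimplex F k → R} (h : IsLocallyFinite ξ) :
    IsLocallyFinite (r • ξ) := by
  intro x
  obtain ⟨V, hV, hf⟩ := h x
  exact ⟨V, hV, hf.subset fun σ hσ => ⟨fun h0 => hσ.1 (by simp [h0]), hσ.2⟩⟩

end closure

/-- The module of locally finite tame `p`-intersection chains of dimension `k`. -/
def bmChains (p : Perversity F) (R : Type v) [CommRing R] (k : ℕ) :
    Submodule R (RegularSimplex F k → R) where
  carrier := {ξ | IsLocallyFinite ξ ∧ IsTameIntersection p ξ}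
  zero_mem' := ⟨.of_finite (by simp), .zero⟩
  add_mem' h h' := ⟨h.1.add h'.1, h.2.add h.1 h'.1 h'.2⟩
  smul_mem' r _ h := ⟨h.1.smul r, h.2.smul r h.1⟩

/-- The module of (finite) tame `p`-intersection chains of dimension `k`. -/
def finChains (p : Perversity F) (R : Type v) [CommRing R] (k : ℕ) :
    Submodule R (RegularSimplex F k → R) where
  carrier := {ξ | {σ | ξ σ ≠ 0}.Finite ∧ IsTameIntersection p ξ}
  zero_mem' := ⟨by simp, .zero⟩
  add_mem' {ξ η} h h' := by
    refine ⟨(h.1.union h'.1).subset fun σ hσ => ?_, h.2.add (.of_finite h.1) (.of_finite h'.1) h'.2⟩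
    by_cases h1 : ξ σ = 0
    · exact Or.inr fun h2 : η σ = 0 => hσ (by simp [h1, h2])
    · exact Or.inl h1
  smul_mem' r ξ h :=
    ⟨h.1.subset fun σ hσ h0 => hσ (by simp [show ξ σ = 0 from h0]), h.2.smul r (.of_finite h.1)⟩

/-- The differential `𝔡` on locally finite tame intersection chains. -/
def bmBoundary (p : Perversity F) (R : Type v) [CommRing R] (k : ℕ) :
    bmChains p R (k + 1) →ₗ[R] bmChains p R k where
  toFun ξ := ⟨boundary ξ.1, ξ.2.1.boundary, ξ.2.2.boundary ξ.2.1⟩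
  map_add' ξ η := Subtype.ext (boundary_add ξ.2.1 η.2.1)
  map_smul' r ξ := Subtype.ext (boundary_smul r ξ.2.1)

/-- The differential `𝔡` on finite tame intersection chains. -/
def finBoundary (p : Perversity F) (R : Type v) [CommRing R] (k : ℕ) :
    finChains p R (k + 1) →ₗ[R] finChains p R k where
  toFun ξ := ⟨boundary ξ.1, finite_support_boundary ξ.2.1, ξ.2.2.boundary (.of_finite ξ.2.1)⟩
  map_add' ξ η := Subtype.ext (boundary_add (.of_finite ξ.2.1) (.of_finite η.2.1))
  map_smul' r ξ := Subtype.ext (boundary_smul r (.of_finite ξ.2.1))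

theorem finBoundary_finBoundary (p : Perversity F) (R : Type v) [CommRing R] (k : ℕ)
    (ξ : finChains p R (k + 2)) : finBoundary p R k (finBoundary p R (k + 1) ξ) = 0 :=
  Subtype.ext (boundary_boundary (.of_finite ξ.2.1))

/-- The complex of locally finite tame `p`-intersection chains. -/
def bmComplex (p : Perversity F) (R : Type v) [CommRing R] :
    ChainComplex (ModuleCat.{max u v} R) ℕ :=
  ChainComplex.of (fun k => ModuleCat.of R (bmChains p R k))
    (fun k => ModuleCat.ofHom (bmBoundary p R k)) fun k => by
      ext ξ : 2
      exact Subtype.ext (boundary_boundary ξ.2.1)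

/-! ### Relative chains -/

/-- A regular simplex of the open subset `U`, seen as a regular simplex of `X`. -/
def RegularSimplex.incl (U : Opens X) {k : ℕ} (σ : RegularSimplex (F.restrict U) k) :
    RegularSimplex F k where
  toMap := ⟨fun t => (σ.toMap t : X), continuous_subtype_val.comp σ.toMap.continuous⟩
  isFace i := σ.isFace i
  isRegular := by
    obtain ⟨j, hj⟩ := σ.isRegular
    exact ⟨j, (F.mem_restrict_layer U _ _).1 hj⟩

section relative

variable (U : Opens X) {k : ℕ}

theorem RegularSimplex.incl_injective :
    Function.Injective (RegularSimplex.incl (F := F) U (k := k)) := by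
  intro σ τ h
  refine RegularSimplex.ext (ContinuousMap.ext fun t => Subtype.ext ?_)
  exact congrArg (fun ρ : RegularSimplex F k => ρ.toMap t) h

theorem incidence_incl (σ : RegularSimplex (F.restrict U) (k + 1))
    (τ : RegularSimplex (F.restrict U) k) :
    incidence (σ.incl U) (τ.incl U) = incidence σ τ := by
  classical
  refine Finset.sum_congr rfl fun i _ => ?_
  congr 1
  refine propext ⟨fun h => ContinuousMap.ext fun t => Subtype.ext ?_, fun h => ?_⟩
  · exact congrArg (fun f : C(Simp k, X) => f t) h
  · refine ContinuousMap.ext fun t => ?_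
    exact congrArg (fun f : C(Simp k, U) => (f t : X)) h

/-- A regular simplex of `X` with image in `U` comes from `U`. -/
theorem exists_incl {τ : RegularSimplex F k} (h : Set.range τ.toMap ⊆ U) :
    ∃ τ' : RegularSimplex (F.restrict U) k, τ'.incl U = τ := by
  refine ⟨{ toMap := ⟨fun t => ⟨τ.toMap t, h ⟨t, rfl⟩⟩, Continuous.subtype_mk
              τ.toMap.continuous _⟩, isFace := τ.isFace, isRegular := ?_ }, rfl⟩
  obtain ⟨j, hj⟩ := τ.isRegular
  exact ⟨j, (F.mem_restrict_layer U _ _).2 hj⟩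

theorem range_incl (σ : RegularSimplex (F.restrict U) k) :
    Set.range (σ.incl U).toMap ⊆ U := by
  rintro _ ⟨t, rfl⟩
  exact (σ.toMap t).2

theorem isAllowable_incl {p : Perversity F} {σ : RegularSimplex (F.restrict U) k}
    (h : σ.IsAllowable (p.restrict U)) : (σ.incl U).IsAllowable p := by
  intro S
  by_cases hS : S.carrier ∩ Set.range (σ.incl U).toMap = ∅
  · rw [FilteredSimplex.perverseDegreeAlong, if_pos hS]
    exact bot_le
  · obtain ⟨x, ⟨hx, hxS⟩, t, rfl⟩ := Set.nonempty_iff_ne_empty.2 hS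
    obtain ⟨i, s⟩ := S
    have hx1 : (σ.toMap t : X) ∈ F.layer i := hx
    have hs : ConnectedComponents.mk (⟨(σ.toMap t : X), hx1⟩ : F.layer i) = s := hxS
    clear hxS
    subst hs
    have hx' : σ.toMap t ∈ (F.restrict U).layer i := (F.mem_restrict_layer U _ _).2 hx
    let S' : (F.restrict U).Stratum := ⟨i, ConnectedComponents.mk ⟨σ.toMap t, hx'⟩⟩
    have hmeet : ¬ S'.carrier ∩ Set.range σ.toMap = ∅ :=
      Set.nonempty_iff_ne_empty.1 ⟨σ.toMap t, ⟨hx', rfl⟩, t, rfl⟩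
    exact (if_neg hS).trans_le ((if_neg hmeet).ge.trans (h S'))

theorem isAllowable_of_incl {p : Perversity F} {σ : RegularSimplex (F.restrict U) k}
    (h : (σ.incl U).IsAllowable p) : σ.IsAllowable (p.restrict U) := by
  intro S
  by_cases hS : S.carrier ∩ Set.range σ.toMap = ∅
  · rw [FilteredSimplex.perverseDegreeAlong, if_pos hS]
    exact bot_le
  · obtain ⟨x, ⟨hx, hxS⟩, t, rfl⟩ := Set.nonempty_iff_ne_empty.2 hS
    obtain ⟨i, s⟩ := S
    have hx1 : σ.toMap t ∈ (F.restrict U).layer i := hx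
    have hs : ConnectedComponents.mk (⟨σ.toMap t, hx1⟩ : (F.restrict U).layer i) = s := hxS
    clear hxS
    subst hs
    let S' : F.Stratum := F.stratumMap U ⟨i, ConnectedComponents.mk ⟨σ.toMap t, hx⟩⟩
    have hmeet : ¬ S'.carrier ∩ Set.range (σ.incl U).toMap = ∅ :=
      Set.nonempty_iff_ne_empty.1
        ⟨(σ.toMap t : X), ⟨(F.mem_restrict_layer U _ _).1 hx, rfl⟩, t, rfl⟩
    exact (if_neg hS).trans_le ((if_neg hmeet).ge.trans (h S'))

/-- The map `i_*` on formal sums of regular simplices that is induced by the inclusion `i` of `U`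
in `X`: the coefficient of `i ∘ σ` is the coefficient of `σ`, and the simplices of `X` that do not
lie in `U` have coefficient `0`. -/
def push (R : Type v) [CommRing R] (ξ : RegularSimplex (F.restrict U) k → R) :
    RegularSimplex F k → R :=
  Function.extend (RegularSimplex.incl U) ξ 0

theorem push_incl (ξ : RegularSimplex (F.restrict U) k → R)
    (σ : RegularSimplex (F.restrict U) k) : push U R ξ (σ.incl U) = ξ σ :=
  (RegularSimplex.incl_injective U).extend_apply _ _ _

theorem push_of_notMem (ξ : RegularSimplex (F.restrict U) k → R) {σ : RegularSimplex F k}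
    (h : ¬ ∃ σ' : RegularSimplex (F.restrict U) k, σ'.incl U = σ) : push U R ξ σ = 0 :=
  Function.extend_apply' _ _ _ h

theorem exists_of_push_ne_zero {ξ : RegularSimplex (F.restrict U) k → R}
    {σ : RegularSimplex F k} (h : push U R ξ σ ≠ 0) :
    ∃ σ' : RegularSimplex (F.restrict U) k, σ'.incl U = σ ∧ ξ σ' ≠ 0 := by
  by_cases hσ : ∃ σ' : RegularSimplex (F.restrict U) k, σ'.incl U = σ
  · obtain ⟨σ', rfl⟩ := hσ
    rw [push_incl] at h
    exact ⟨σ', rfl, h⟩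
  · exact absurd (push_of_notMem U ξ hσ) h

theorem push_add (ξ η : RegularSimplex (F.restrict U) k → R) :
    push U R (ξ + η) = push U R ξ + push U R η := by
  funext σ
  by_cases hσ : ∃ σ' : RegularSimplex (F.restrict U) k, σ'.incl U = σ
  · obtain ⟨σ', rfl⟩ := hσ
    simp only [Pi.add_apply, push_incl]
  · simp only [Pi.add_apply, push_of_notMem U _ hσ, add_zero]

theorem push_smul (r : R) (ξ : RegularSimplex (F.restrict U) k → R) :
    push U R (r • ξ) = r • push U R ξ := by
  funext σ
  by_cases hσ : ∃ σ' : RegularSimplex (F.restrict U) k, σ'.incl U = σ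
  · obtain ⟨σ', rfl⟩ := hσ
    simp only [Pi.smul_apply, push_incl]
  · simp only [Pi.smul_apply, push_of_notMem U _ hσ, smul_zero]

theorem boundary_push (ξ : RegularSimplex (F.restrict U) (k + 1) → R) :
    boundary (push U R ξ) = push U R (boundary ξ) := by
  funext τ
  by_cases hτ : ∃ τ' : RegularSimplex (F.restrict U) k, τ'.incl U = τ
  · obtain ⟨τ', rfl⟩ := hτ
    rw [push_incl]
    have h1 : ∀ σ', incidence (σ'.incl U) (τ'.incl U) • push U R ξ (σ'.incl U)
        = incidence σ' τ' • ξ σ' := fun σ' => by rw [push_incl, incidence_incl]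
    rw [boundary, boundary, ← finsum_congr h1,
      ← finsum_mem_range (f := fun σ => incidence σ (τ'.incl U) • push U R ξ σ)
        (RegularSimplex.incl_injective U), finsum_mem_def]
    refine finsum_congr fun σ => ?_
    by_cases hσ : σ ∈ Set.range (RegularSimplex.incl (F := F) U (k := k + 1))
    · rw [Set.indicator_of_mem hσ]
    · rw [Set.indicator_of_notMem hσ, push_of_notMem U ξ hσ, smul_zero]
  · rw [push_of_notMem U _ hτ]
    refine (finsum_congr fun σ => ?_).trans finsum_zero
    by_cases h0 : push U R ξ σ = 0
    · rw [h0, smul_zero]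
    · obtain ⟨σ', rfl, -⟩ := exists_of_push_ne_zero U h0
      by_cases h1 : incidence (σ'.incl U) τ = 0
      · rw [h1, zero_smul]
      · exact absurd (exists_incl U
          ((range_subset_of_incidence h1).trans (range_incl U σ'))) hτ

theorem IsTame.push {p : Perversity F} {ξ : RegularSimplex (F.restrict U) k → R}
    (h : IsTame (p.restrict U) ξ) : IsTame p (push U R ξ) := by
  intro σ hσ
  obtain ⟨σ', rfl, h0⟩ := exists_of_push_ne_zero U hσ
  exact isAllowable_incl U (h σ' h0)

theorem IsTameIntersection.push {p : Perversity F} {ξ : RegularSimplex (F.restrict U) k → R}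
    (h : IsTameIntersection (p.restrict U) ξ) : IsTameIntersection p (push U R ξ) := by
  cases k with
  | zero => exact IsTame.push U h
  | succ k => exact ⟨h.1.push U, by rw [boundary_push]; exact h.2.push U⟩

/-- The chain map `C^p(U; R) → C^p(X; R)` induced by the inclusion of the open subset `U`. -/
def finPush (p : Perversity F) (R : Type v) [CommRing R] (k : ℕ) :
    finChains (p.restrict U) R k →ₗ[R] finChains p R k where
  toFun ξ := ⟨push U R ξ.1, (ξ.2.1.image (RegularSimplex.incl U)).subset fun σ hσ => by
    obtain ⟨σ', h, h0⟩ := exists_of_push_ne_zero U hσ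
    exact ⟨σ', h0, h⟩, ξ.2.2.push U⟩
  map_add' ξ η := Subtype.ext (push_add U ξ.1 η.1)
  map_smul' r ξ := Subtype.ext (push_smul U r ξ.1)

theorem finBoundary_finPush (p : Perversity F) (R : Type v) [CommRing R] (k : ℕ)
    (ξ : finChains (p.restrict U) R (k + 1)) :
    finBoundary p R k (finPush U p R (k + 1) ξ)
      = finPush U p R k (finBoundary (p.restrict U) R k ξ) :=
  Subtype.ext (boundary_push U ξ.1)

/-- The relative chains `C^p(X, U; R) = C^p(X; R) / C^p(U; R)` of dimension `k`. -/
abbrev relChains (p : Perversity F) (R : Type v) [CommRing R] (k : ℕ) : Type (max u v) :=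
  finChains p R k ⧸ LinearMap.range (finPush U p R k)

/-- The class in `C^p(X, U; R)` of a chain of `C^p(X; R)`. -/
abbrev relClass (p : Perversity F) (R : Type v) [CommRing R] (k : ℕ) :
    finChains p R k →ₗ[R] relChains U p R k :=
  (LinearMap.range (finPush U p R k)).mkQ

/-- The differential of the relative complex. -/
def relBoundary (p : Perversity F) (R : Type v) [CommRing R] (k : ℕ) :
    relChains U p R (k + 1) →ₗ[R] relChains U p R k :=
  Submodule.mapQ _ _ (finBoundary p R k) <| by
    rintro _ ⟨ξ, rfl⟩
    exact ⟨finBoundary (p.restrict U) R k ξ, (finBoundary_finPush U p R k ξ).symm⟩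

/-- The relative complex `C^p(X, U; R)`. -/
def relComplex (p : Perversity F) (R : Type v) [CommRing R] :
    ChainComplex (ModuleCat.{max u v} R) ℕ :=
  ChainComplex.of (fun k => ModuleCat.of R (relChains U p R k))
    (fun k => ModuleCat.ofHom (relBoundary U p R k)) fun k => by
      refine ModuleCat.hom_ext (LinearMap.ext fun x => ?_)
      obtain ⟨ξ, rfl⟩ := Submodule.mkQ_surjective _ x
      exact congrArg (relClass U p R k) (finBoundary_finBoundary p R k ξ)

/-- A finite tame intersection chain of `X` whose simplices lie in `U` comes from `U`. -/
theorem exists_finPush_eq {p : Perversity F} {ζ : finChains p R k}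
    (h : ∀ σ, ζ.1 σ ≠ 0 → Set.range σ.toMap ⊆ U) : ∃ η, finPush U p R k η = ζ := by
  let η : RegularSimplex (F.restrict U) k → R := fun σ => ζ.1 (σ.incl U)
  have hη : push U R η = ζ.1 := by
    funext σ
    by_cases hσ : ∃ σ' : RegularSimplex (F.restrict U) k, σ'.incl U = σ
    · obtain ⟨σ', rfl⟩ := hσ
      exact push_incl U η σ'
    · rw [push_of_notMem U η hσ]
      by_contra h0
      exact hσ (exists_incl U (h σ (Ne.symm h0)))
  have htame : ∀ {l : ℕ} (θ : RegularSimplex (F.restrict U) l → R), IsTame p (push U R θ) →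
      IsTame (p.restrict U) θ := fun θ hθ σ hσ =>
    isAllowable_of_incl U (hθ (σ.incl U) (by rwa [push_incl]))
  have hint : IsTameIntersection (p.restrict U) η := by
    have hζ : IsTameIntersection p (push U R η) := by rw [hη]; exact ζ.2.2
    clear_value η
    cases k with
    | zero => exact htame η hζ
    | succ k => exact ⟨htame η hζ.1, htame _ (by rw [← boundary_push]; exact hζ.2)⟩
  exact ⟨⟨η, ζ.2.1.preimage (RegularSimplex.incl_injective U).injOn, hint⟩, Subtype.ext hη⟩

variable {U} in
theorem range_finPush_mono {V : Opens X} (h : U ≤ V) (p : Perversity F) (R : Type v)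
    [CommRing R] (k : ℕ) :
    LinearMap.range (finPush U p R k) ≤ LinearMap.range (finPush V p R k) := by
  rintro _ ⟨ξ, rfl⟩
  refine exists_finPush_eq V fun σ hσ => ?_
  obtain ⟨σ', rfl, -⟩ := exists_of_push_ne_zero U hσ
  exact (range_incl U σ').trans h

variable {U} in
/-- For open subsets `U ⊆ V` the map `C^p(X, U; R) → C^p(X, V; R)` induced by the identity. -/
def relMap {V : Opens X} (h : U ≤ V) (p : Perversity F) (R : Type v) [CommRing R] (k : ℕ) :
    relChains U p R k →ₗ[R] relChains V p R k :=
  Submodule.factor (range_finPush_mono h p R k)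

end relative

/-! ### The inverse system of the compact subsets -/

/-- The complement of a compact subset. -/
def complCompact [T2Space X] (K : Compacts X) : Opens X :=
  ⟨(K : Set X)ᶜ, K.isCompact.isClosed.isOpen_compl⟩

theorem complCompact_anti [T2Space X] {K L : Compacts X} (h : K ≤ L) :
    complCompact L ≤ complCompact K := fun _ hx hK => hx (h hK)

/-- The inverse system `K ↦ C^p(X, X \ K; R)`, over the compact subsets `K` of `X` ordered by
inclusion. -/
def relSystem [T2Space X] (p : Perversity F) (R : Type v) [CommRing R] :
    (Compacts X)ᵒᵖ ⥤ ChainComplex (ModuleCat.{max u v} R) ℕ where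
  obj K := relComplex (complCompact K.unop) p R
  map {K L} f := ChainComplex.ofHom
    (fun k => ModuleCat.ofHom (relMap (complCompact_anti (leOfHom f.unop)) p R k)) fun k => by
      simp only [relComplex, ChainComplex.of_d]
      refine ModuleCat.hom_ext (LinearMap.ext fun x => ?_)
      obtain ⟨ξ, rfl⟩ := Submodule.mkQ_surjective _ x
      rfl
  map_id K := by
    ext k x : 3
    obtain ⟨ξ, rfl⟩ := Submodule.mkQ_surjective _ x
    rfl
  map_comp f g := by
    ext k x : 3
    obtain ⟨ξ, rfl⟩ := Submodule.mkQ_surjective _ x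
    rfl

end Perv

end

noncomputable section

namespace Perv

variable {X : Type u} [TopologicalSpace X] {n : ℕ} {F : ClosedFiltration X n} {k : ℕ}

/-! ### Non-allowable faces -/

/-! Two chains have the same class relative to `X \ K` exactly when their coefficients agree on all
simplices that meet `K` (`relClass_eq_relClass_iff`). Both directions of the isomorphism are thus
statements about coefficients.

The difficulty is to cut a locally finite chain `ξ` down to a finite one that agrees with it on `K`.
Keeping only the simplices that meet `K` preserves allowability of the simplices but may destroy
that of the boundary: a non-allowable face whose coefficient cancels in `𝔡ξ` need no longer cancel.
So the kept set has to be closed under passing from a simplex to any other simplex of `ξ` with a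
common non-allowable face, and the point is that this closure stays finite.

If a face `τ` of an allowable `σ` violates the condition at a stratum of dimension `i`, the omitted
vertex does not lie in `Xᵢ`; otherwise both sides of the inequality would drop by one
(`exists_level_of_not_allowable`). Hence `τ` contains all of `σ ∩ Xᵢ`, and two simplices that share
`τ` have the same non-empty trace on `Xᵢ` (`linkedAlong_of_face`). Among all links reachable from a
simplex, let `i` be the least level that occurs: the trace on `Xᵢ` is constant along every path, so
every simplex reached meets one fixed compact set, and local finiteness leaves finitely many
(`finite_linked`). This gives `exists_finChains_agreeOn`.

Conversely, given a compatible family of relative classes, the coefficient of `σ` is read off at the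
compact set `K = im σ`. Compatibility makes the resulting sum agree with the representative at every
`K`, which yields tameness, local finiteness and uniqueness (`existsUnique_bmToRel`). -/

theorem vertex_mem_faceSet {A : Finset (Fin (k + 1))} {j : Fin (k + 1)} :
    (stdSimplex.vertex j : Simp k) ∈ faceSet A ↔ j ∈ A := by
  constructor
  · intro h
    by_contra hj
    have := h j hj
    simp [stdSimplex.vertex_coe] at this
  · intro h l hl
    rw [stdSimplex.vertex_coe]
    exact Pi.single_eq_of_ne (by rintro rfl; exact hl h) _

/-- A face is determined by the vertices it contains, so the unspecified vertex set in `isFace` must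
be `joinVertices`. -/
theorem FilteredSimplex.preimage_level (σ : FilteredSimplex F k) (i : Fin (n + 1)) :
    σ.toMap ⁻¹' F.level i = faceSet (σ.joinVertices i) := by
  classical
  obtain ⟨A, hA⟩ := σ.isFace i
  have : σ.joinVertices i = A := by
    ext j
    rw [FilteredSimplex.joinVertices, Finset.mem_filter, ← vertex_mem_faceSet (A := A), ← hA]
    simp
  rw [hA, this]

theorem exists_faceMap_eq {v : Fin (k + 2)} {y : Simp (k + 1)} (h : y v = 0) :
    ∃ x : Simp k, faceMap v x = y := by
  refine ⟨⟨fun l => y (v.succAbove l), fun l => y.2.1 _, ?_⟩, ?_⟩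
  · have := y.2.2
    rw [Fin.sum_univ_succAbove _ v] at this
    change y v + _ = 1 at this
    rwa [h, zero_add] at this
  · refine Subtype.ext (funext fun j => ?_)
    rcases Fin.eq_self_or_eq_succAbove v j with rfl | ⟨l, rfl⟩
    · exact (faceMap_apply_self _ _).trans h.symm
    · exact faceMap_apply_succAbove v _ l

/-- Omitting a vertex that lies in `Xᵢ` lowers the dimension of the part in `Xᵢ` by exactly one, the
same amount by which the dimension of the whole simplex drops. -/
theorem card_joinVertices_face {σ : FilteredSimplex F (k + 1)} {τ : FilteredSimplex F k}
    {v : Fin (k + 2)} (h : τ.toMap = σ.toMap.comp (faceMap v)) {i : Fin (n + 1)}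
    (hv : v ∈ σ.joinVertices i) : (σ.joinVertices i).card = (τ.joinVertices i).card + 1 := by
  classical
  have himg : σ.joinVertices i = insert v ((τ.joinVertices i).map v.succAboveEmb) := by
    ext j
    rcases Fin.eq_self_or_eq_succAbove v j with rfl | ⟨l, rfl⟩
    · simp [hv]
    · have : faceMap v (stdSimplex.vertex l) = stdSimplex.vertex (v.succAbove l) :=
        stdSimplex.map_vertex _ _
      simp [FilteredSimplex.joinVertices, h, this, Fin.succAbove_ne]
  rw [himg, Finset.card_insert_of_notMem (by simp [Fin.succAbove_ne]), Finset.card_map]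

/-- If a face `τ` of an allowable simplex `σ` is not allowable, then for some `i` it contains the
non-empty part of `σ` that lies in `Xᵢ`. -/
theorem exists_level_of_not_allowable {p : Perversity F} {σ : FilteredSimplex F (k + 1)}
    {τ : FilteredSimplex F k} {v : Fin (k + 2)} (h : τ.toMap = σ.toMap.comp (faceMap v))
    (hσ : σ.IsAllowable p) {S : F.Stratum}
    (hS : ¬ τ.perverseDegreeAlong S ≤
      (((k : ℤ) - ((S.codim : ℕ) : ℤ) + p.toFun S : ℤ) : WithBot ℤ)) :
    (Set.range τ.toMap ∩ F.level S.dim).Nonempty ∧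
      Set.range σ.toMap ∩ F.level S.dim ⊆ Set.range τ.toMap := by
  have hmeet : ¬ S.carrier ∩ Set.range τ.toMap = ∅ := fun h0 => hS (by
    rw [FilteredSimplex.perverseDegreeAlong, if_pos h0]; exact bot_le)
  have hsub : Set.range τ.toMap ⊆ Set.range σ.toMap := by
    rw [h]; rintro _ ⟨t, rfl⟩; exact ⟨_, rfl⟩
  have hmeet' : ¬ S.carrier ∩ Set.range σ.toMap = ∅ := fun h0 =>
    hmeet (Set.subset_empty_iff.1 (h0 ▸ Set.inter_subset_inter_right _ hsub))
  have h1 := hσ S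
  have hrev : S.codim.rev = S.dim := Fin.rev_rev _
  rw [FilteredSimplex.perverseDegreeAlong, if_neg hmeet, FilteredSimplex.perverseDegree,
    hrev] at hS
  rw [FilteredSimplex.perverseDegreeAlong, if_neg hmeet', FilteredSimplex.perverseDegree,
    hrev] at h1
  refine ⟨?_, ?_⟩
  · obtain ⟨x, ⟨hx, -⟩, hx'⟩ := Set.nonempty_iff_ne_empty.2 hmeet
    exact ⟨x, hx', hx.1⟩
  -- If `v` were in the part lying in `Xᵢ`, both sides of the inequality for `σ` would decrease by
  -- one on passing to `τ`, so `τ` would satisfy it too.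
  · have hv : v ∉ σ.joinVertices S.dim := by
      intro hv
      have hcard := card_joinVertices_face h hv
      -- The empty face has dimension `⊥` and violates nothing; excluding it turns both inequalities
      -- into ones between integers.
      have hτ0 : τ.joinVertices S.dim ≠ ∅ := fun h0 => hS (by
        rw [FilteredSimplex.faceDim, if_pos h0]; exact bot_le)
      have hσ0 : σ.joinVertices S.dim ≠ ∅ := fun h0 => by simp [h0] at hcard
      rw [FilteredSimplex.faceDim, if_neg hτ0, WithBot.coe_le_coe] at hS
      rw [FilteredSimplex.faceDim, if_neg hσ0, WithBot.coe_le_coe] at h1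
      push_cast at h1
      omega
    -- A point of `σ` in `Xᵢ` has vanishing `v`-coordinate, hence lies on the face opposite `v`.
    rintro _ ⟨⟨y, rfl⟩, hy⟩
    have hy' : y ∈ faceSet (σ.joinVertices S.dim) := by rw [← σ.preimage_level]; exact hy
    obtain ⟨x, rfl⟩ := exists_faceMap_eq (hy' v hv)
    exact ⟨x, by rw [h]; rfl⟩

variable {R : Type v}

/-! ### Formal sums that agree on a subset -/

/-- Two formal sums have the same coefficients on all simplices that meet `K`. -/
def AgreeOn (K : Set X) (ξ η : RegularSimplex F k → R) : Prop :=
  ∀ σ : RegularSimplex F k, (Set.range σ.toMap ∩ K).Nonempty → ξ σ = η σ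

theorem AgreeOn.symm {K : Set X} {ξ η : RegularSimplex F k → R} (h : AgreeOn K ξ η) :
    AgreeOn K η ξ := fun σ hσ => (h σ hσ).symm

theorem AgreeOn.trans {K : Set X} {ξ η ζ : RegularSimplex F k → R} (h : AgreeOn K ξ η)
    (h' : AgreeOn K η ζ) : AgreeOn K ξ ζ := fun σ hσ => (h σ hσ).trans (h' σ hσ)

theorem AgreeOn.mono {K L : Set X} (hKL : K ⊆ L) {ξ η : RegularSimplex F k → R}
    (h : AgreeOn L ξ η) : AgreeOn K ξ η :=
  fun σ hσ => h σ (hσ.mono (Set.inter_subset_inter_right _ hKL))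

variable [CommRing R]

/-! ### Linked simplices -/

/-- A simplex `σ` is linked along `Xᵢ` with a simplex `σ'` of the formal sum `ξ` if both images have
the same non-empty intersection with `Xᵢ`. -/
def LinkedAlong (ξ : RegularSimplex F (k + 1) → R) (i : Fin (n + 1))
    (σ σ' : RegularSimplex F (k + 1)) : Prop :=
  ξ σ' ≠ 0 ∧ (Set.range σ.toMap ∩ F.level i).Nonempty ∧
    Set.range σ.toMap ∩ F.level i = Set.range σ'.toMap ∩ F.level i

/-- Two simplices of a tame sum with a common non-allowable face are linked. -/
theorem linkedAlong_of_face {p : Perversity F} {ξ : RegularSimplex F (k + 1) → R}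
    (hξ : IsTame p ξ) {σ σ' : RegularSimplex F (k + 1)} (hσ : ξ σ ≠ 0) (hσ' : ξ σ' ≠ 0)
    {τ : RegularSimplex F k} (hτ : ¬ τ.IsAllowable p) (h : incidence σ τ ≠ 0)
    (h' : incidence σ' τ ≠ 0) : ∃ i, LinkedAlong ξ i σ σ' := by
  obtain ⟨S, hS⟩ := not_forall.1 hτ
  obtain ⟨v, hv⟩ := exists_face_of_incidence h
  obtain ⟨v', hv'⟩ := exists_face_of_incidence h'
  obtain ⟨hne, h1⟩ := exists_level_of_not_allowable hv (hξ σ hσ) hS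
  obtain ⟨-, h2⟩ := exists_level_of_not_allowable hv' (hξ σ' hσ') hS
  have hs := range_subset_of_incidence h
  have hs' := range_subset_of_incidence h'
  -- The same stratum `S` serves both simplices: each trace on the level of `S` equals that of `τ`.
  exact ⟨S.dim, hσ', hne.mono (Set.inter_subset_inter_left _ hs),
    Set.Subset.antisymm (fun x hx => ⟨hs' (h1 hx), hx.2⟩) fun x hx => ⟨hs (h2 hx), hx.2⟩⟩

/-- The relation generated by links along the various `Xᵢ`. -/
def Linked (ξ : RegularSimplex F (k + 1) → R) :
    RegularSimplex F (k + 1) → RegularSimplex F (k + 1) → Prop :=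
  Relation.ReflTransGen fun σ σ' => ∃ i, LinkedAlong ξ i σ σ'

/-- The key finiteness: a simplex of a locally finite sum is linked to finitely many simplices.
If `i` is minimal such that a link along `Xᵢ` occurs, all of them have the same non-empty compact
intersection with `Xᵢ`. -/
theorem finite_linked {ξ : RegularSimplex F (k + 1) → R}
    (hξ : IsLocallyFinite ξ) (σ : RegularSimplex F (k + 1)) :
    {σ' | Linked ξ σ σ'}.Finite := by
  classical
  by_cases hex : ∃ i, ∃ ρ ρ', Linked ξ σ ρ ∧ LinkedAlong ξ i ρ ρ'
  · obtain ⟨i, ⟨ρ, ρ', hρ, hlink⟩, hmin⟩ := WellFounded.has_min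
      (wellFounded_lt (α := Fin (n + 1))) {i | ∃ ρ ρ', Linked ξ σ ρ ∧ LinkedAlong ξ i ρ ρ'}
      hex
    have hconst : ∀ σ', Linked ξ σ σ' →
        Set.range σ.toMap ∩ F.level i = Set.range σ'.toMap ∩ F.level i := by
      intro σ' h
      induction h with
      | refl => rfl
      | @tail b c hb hbc ih =>
        obtain ⟨j, hj⟩ := hbc
        -- By minimality `i ≤ j`, so the equality of traces on `Xⱼ` restricts to one on `Xᵢ`.
        have hij : F.level i ⊆ F.level j :=
          F.monotone_level (not_lt.1 (hmin j ⟨b, c, hb, hj⟩))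
        rw [ih, ← Set.inter_eq_self_of_subset_right hij, ← Set.inter_assoc, hj.2.2,
          Set.inter_assoc]
    have hne : (Set.range σ.toMap ∩ F.level i).Nonempty := by
      rw [hconst ρ hρ]; exact hlink.2.1
    have hK : IsCompact (Set.range σ.toMap ∩ F.level i) :=
      (isCompact_range σ.toMap.continuous).inter_right (F.isClosed_level i)
    -- The start `σ` is added separately, since it need not occur in `ξ`; the end of any non-trivial
    -- path does.
    refine ((hξ.finite_meet hK).insert σ).subset fun σ' h => ?_
    rcases Relation.ReflTransGen.cases_tail h with rfl | ⟨b, -, j, hj⟩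
    · exact Or.inl rfl
    · refine Or.inr ⟨hj.1, ?_⟩
      obtain ⟨x, hx⟩ := hne
      exact ⟨x, (hconst σ' h ▸ hx).1, hx⟩
  · refine (Set.finite_singleton σ).subset fun σ' h => ?_
    rcases Relation.ReflTransGen.cases_head h with rfl | ⟨b, ⟨j, hj⟩, -⟩
    · rfl
    · exact absurd ⟨j, σ, b, .refl, hj⟩ hex

/-! ### Cutting off a locally finite chain -/

theorem AgreeOn.boundary {K : Set X} {ξ η : RegularSimplex F (k + 1) → R}
    (h : AgreeOn K ξ η) : AgreeOn K (boundary ξ) (boundary η) := by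
  intro τ hτ
  refine finsum_congr fun σ => ?_
  by_cases h0 : incidence σ τ = 0
  · rw [h0, zero_smul, zero_smul]
  · rw [h σ (hτ.mono (Set.inter_subset_inter_left _ (range_subset_of_incidence h0)))]

/-- A locally finite tame intersection chain agrees on the simplices that meet a given compact
set with a finite tame intersection chain. -/
theorem exists_finChains_agreeOn {p : Perversity F} (c : bmChains p R k) {K : Set X}
    (hK : IsCompact K) : ∃ d : finChains p R k, AgreeOn K d.1 c.1 := by
  classical
  obtain ⟨ξ, hξ, ht⟩ := c
  have hfin := hξ.finite_meet hK
  cases k with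
  | zero =>
    -- In degree `0` there is no boundary condition, so plain truncation works.
    let T := {σ | ξ σ ≠ 0 ∧ (Set.range σ.toMap ∩ K).Nonempty}
    refine ⟨⟨fun σ => if σ ∈ T then ξ σ else 0, hfin.subset fun σ hσ => ?_, fun σ hσ => ?_⟩,
      fun σ hσ => ?_⟩
    · by_contra h; exact hσ (if_neg h)
    · refine ht σ fun h => hσ ?_
      simp [h]
    · change (if σ ∈ T then ξ σ else 0) = ξ σ
      split_ifs with h
      · rfl
      · by_contra h0; exact h ⟨Ne.symm h0, hσ⟩
  | succ k =>
    let T := {σ | ξ σ ≠ 0 ∧ (Set.range σ.toMap ∩ K).Nonempty}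
    -- The closure of `T` under links: finite, and any bad face is kept with all its cofaces in `ξ`
    -- or with none.
    let C := ⋃ σ ∈ T, {σ' | Linked ξ σ σ'}
    have hC : C.Finite := hfin.biUnion fun σ _ => finite_linked hξ σ
    have hclosed : ∀ {σ σ'}, σ ∈ C → (∃ i, LinkedAlong ξ i σ σ') → σ' ∈ C := by
      intro σ σ' h hl
      obtain ⟨ρ, hρ, h⟩ := Set.mem_iUnion₂.1 h
      exact Set.mem_biUnion hρ (Relation.ReflTransGen.tail h hl)
    let d : RegularSimplex F (k + 1) → R := fun σ => if σ ∈ C then ξ σ else 0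
    have hdC : ∀ {σ}, d σ ≠ 0 → σ ∈ C ∧ ξ σ ≠ 0 := by
      intro σ hσ
      by_cases h : σ ∈ C
      · exact ⟨h, by rwa [show d σ = ξ σ from if_pos h] at hσ⟩
      · exact absurd (if_neg h) hσ
    have hbd : IsTame p (boundary d) := by
      intro τ hτ
      by_contra hbad
      refine hτ ?_
      -- For a non-allowable `τ`, one coface in `C` forces all cofaces from `ξ` into `C`; the
      -- coefficient of `τ` is then that in `𝔡ξ`, which vanishes. Without such a coface every term
      -- is zero.
      by_cases hex : ∃ σ ∈ C, ξ σ ≠ 0 ∧ incidence σ τ ≠ 0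
      · obtain ⟨σ, hσC, hσ, hi⟩ := hex
        have h0 : boundary ξ τ = 0 := by
          by_contra h0
          exact hbad (ht.2 τ h0)
        rw [← h0]
        refine finsum_congr fun σ' => ?_
        by_cases hi' : incidence σ' τ = 0
        · rw [hi', zero_smul, zero_smul]
        by_cases hσ' : ξ σ' = 0
        · simp [d, hσ']
        · rw [show d σ' = ξ σ' from if_pos
            (hclosed hσC (linkedAlong_of_face ht.1 hσ hσ' hbad hi hi'))]
      · refine (finsum_congr fun σ => ?_).trans finsum_zero
        by_cases h0 : d σ = 0
        · rw [h0, smul_zero]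
        · have hσ := hdC h0
          by_cases hi : incidence σ τ = 0
          · rw [hi, zero_smul]
          · exact absurd ⟨σ, hσ.1, hσ.2, hi⟩ hex
    refine ⟨⟨d, hC.subset fun σ hσ => (hdC hσ).1, fun σ hσ => ht.1 σ (hdC hσ).2, hbd⟩,
      fun σ hσ => ?_⟩
    by_cases h0 : ξ σ = 0
    · change (if σ ∈ C then ξ σ else 0) = ξ σ
      simp [h0]
    · exact if_pos (Set.mem_biUnion (show σ ∈ T from ⟨h0, hσ⟩) Relation.ReflTransGen.refl)

/-! ### Relative classes -/

variable [T2Space X]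

/-- A tame chain comes from `X \ K` as soon as each of its simplices avoids `K`, because
allowability can be tested in the open subset; apply this to `d - d'`. -/
theorem relClass_eq_relClass_iff {p : Perversity F} {K : Compacts X} {d d' : finChains p R k} :
    relClass (complCompact K) p R k d = relClass (complCompact K) p R k d' ↔
      AgreeOn (K : Set X) d.1 d'.1 := by
  change (Submodule.Quotient.mk d : relChains (complCompact K) p R k) = Submodule.Quotient.mk d' ↔ _
  rw [Submodule.Quotient.eq]
  constructor
  · rintro ⟨η, hη⟩ σ ⟨x, hx, hxK⟩
    have h1 : push (complCompact K) R η.1 σ = d.1 σ - d'.1 σ :=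
      congrArg (fun ζ : finChains p R k => ζ.1 σ) hη
    rw [push_of_notMem] at h1
    · exact (sub_eq_zero.1 h1.symm)
    · rintro ⟨σ', rfl⟩
      exact range_incl (complCompact K) σ' hx hxK
  · intro h
    refine exists_finPush_eq _ fun σ hσ x hx hxK => hσ ?_
    exact sub_eq_zero.2 (h σ ⟨x, hx, hxK⟩)

/-- The class in `C^p(X, X \ K; R)` of a locally finite chain. -/
def bmToRel (p : Perversity F) (R : Type v) [CommRing R] (K : Compacts X) (k : ℕ) :
    bmChains p R k →ₗ[R] relChains (complCompact K) p R k where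
  toFun c := relClass (complCompact K) p R k
    (exists_finChains_agreeOn c K.isCompact).choose
  -- The chosen representatives need not be additive, but their sum agrees on `K` with the
  -- representative of the sum.
  map_add' c c' := by
    rw [← map_add, relClass_eq_relClass_iff]
    intro σ hσ
    refine ((exists_finChains_agreeOn (c + c') K.isCompact).choose_spec σ hσ).trans ?_
    exact (congrArg₂ (· + ·) ((exists_finChains_agreeOn c K.isCompact).choose_spec σ hσ)
      ((exists_finChains_agreeOn c' K.isCompact).choose_spec σ hσ)).symm
  map_smul' r c := by
    rw [RingHom.id_apply, ← map_smul, relClass_eq_relClass_iff]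
    intro σ hσ
    refine ((exists_finChains_agreeOn (r • c) K.isCompact).choose_spec σ hσ).trans ?_
    exact (congrArg (r • ·) ((exists_finChains_agreeOn c K.isCompact).choose_spec σ hσ)).symm

/-- Frees `bmToRel` from the choice in its definition: any finite tame chain that agrees with `c` on
`K` may be used. -/
theorem bmToRel_eq_iff {p : Perversity F} {K : Compacts X} {c : bmChains p R k}
    {d : finChains p R k} :
    bmToRel p R K k c = relClass (complCompact K) p R k d ↔ AgreeOn (K : Set X) d.1 c.1 := by
  have h := (exists_finChains_agreeOn c K.isCompact).choose_spec
  refine relClass_eq_relClass_iff.trans ⟨fun h' => h'.symm.trans h, fun h' => h.trans h'.symm⟩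

/-- A compatible family of relative classes comes from a unique locally finite chain. -/
theorem existsUnique_bmToRel [LocallyCompactSpace X] {p : Perversity F}
    (x : ∀ K : Compacts X, relChains (complCompact K) p R k)
    (hx : ∀ (K L : Compacts X) (h : K ≤ L), relMap (complCompact_anti h) p R k (x L) = x K) :
    ∃! c : bmChains p R k, ∀ K, bmToRel p R K k c = x K := by
  choose d hd using fun K => Submodule.mkQ_surjective _ (x K)
  have hcompat : ∀ K L : Compacts X, K ≤ L → AgreeOn (K : Set X) (d L).1 (d K).1 := by
    intro K L h
    rw [← relClass_eq_relClass_iff]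
    refine Eq.trans ?_ (hd K).symm
    rw [← hx K L h, ← hd L]
    rfl
  let im : ∀ {l : ℕ}, RegularSimplex F l → Compacts X := fun σ =>
    ⟨Set.range σ.toMap, isCompact_range σ.toMap.continuous⟩
  -- Every simplex meets its own image, so the class at `im σ` determines the coefficient of `σ`.
  let c : RegularSimplex F k → R := fun σ => (d (im σ)).1 σ
  have hagree : ∀ K : Compacts X, AgreeOn (K : Set X) (d K).1 c := by
    intro K σ hσ
    -- `K` and `im σ` are compared through the representative at their union.
    have h1 := hcompat K (K ⊔ im σ) le_sup_left σ hσ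
    have h2 := hcompat (im σ) (K ⊔ im σ) le_sup_right σ
      (by rw [show (im σ : Set X) = Set.range σ.toMap from rfl, Set.inter_self]
          exact Set.range_nonempty _)
    exact h1.symm.trans h2
  -- Tameness is a condition on one simplex at a time, so it can be checked on a chain that agrees
  -- with `ξ` on the image of that simplex. This applies to `c` and to `𝔡c` alike.
  have htame : ∀ {l : ℕ} (ξ : RegularSimplex F l → R),
      (∀ K : Compacts X, ∃ η : RegularSimplex F l → R, IsTame p η ∧ AgreeOn (K : Set X) η ξ) →
      IsTame p ξ := by
    intro l ξ h σ hσ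
    obtain ⟨η, hη, ha⟩ := h (im σ)
    refine hη σ ?_
    rwa [ha σ (by rw [show (im σ : Set X) = Set.range σ.toMap from rfl, Set.inter_self]
                  exact Set.range_nonempty _)]
  have hint : IsTameIntersection p c := by
    clear_value c
    cases k with
    | zero => exact htame c fun K => ⟨_, (d K).2.2, hagree K⟩
    | succ k =>
      exact ⟨htame c fun K => ⟨_, (d K).2.2.1, hagree K⟩,
        htame _ fun K => ⟨_, (d K).2.2.2, (hagree K).boundary⟩⟩
  have hlf : IsLocallyFinite c := by
    intro y
    -- On a compact neighbourhood `L` of `y` the sum agrees with the finite chain `d L`.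
    obtain ⟨L, hL, hy⟩ := exists_compact_mem_nhds y
    refine ⟨L, hy, (d ⟨L, hL⟩).2.1.subset fun σ hσ => ?_⟩
    have := hagree ⟨L, hL⟩ σ hσ.2
    exact fun h0 => hσ.1 (this ▸ h0)
  refine ⟨⟨c, hlf, hint⟩, fun K => ?_, fun c' hc' => Subtype.ext (funext fun σ => ?_)⟩
  · rw [← hd K]
    exact bmToRel_eq_iff.2 (hagree K)
  · have h := hc' (im σ)
    rw [← hd (im σ)] at h
    refine ((bmToRel_eq_iff.1 h) σ ?_).symm
    rw [show (im σ : Set X) = Set.range σ.toMap from rfl, Set.inter_self]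
    exact Set.range_nonempty _

theorem relBoundary_bmToRel (p : Perversity F) (K : Compacts X) (c : bmChains p R (k + 1)) :
    relBoundary (complCompact K) p R k (bmToRel p R K (k + 1) c)
      = bmToRel p R K k (bmBoundary p R k c) := by
  obtain ⟨d, hd⟩ := exists_finChains_agreeOn c K.isCompact
  rw [bmToRel_eq_iff.2 hd]
  exact (bmToRel_eq_iff.2 (AgreeOn.boundary hd) : _ = relClass _ p R k (finBoundary p R k d)).symm

theorem relMap_bmToRel (p : Perversity F) {K L : Compacts X} (h : K ≤ L) (c : bmChains p R k) :
    relMap (complCompact_anti h) p R k (bmToRel p R L k c) = bmToRel p R K k c := by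
  obtain ⟨d, hd⟩ := exists_finChains_agreeOn c L.isCompact
  rw [bmToRel_eq_iff.2 hd, bmToRel_eq_iff.2 (hd.mono h)]
  rfl

/-! ### The limit cone -/

/-- The chain map from the locally finite chains to the chains relative to `X \ K`. -/
def bmToRelComplex (p : Perversity F) (R : Type v) [CommRing R] (K : Compacts X) :
    bmComplex p R ⟶ relComplex (complCompact K) p R :=
  ChainComplex.ofHom (fun k => ModuleCat.ofHom (bmToRel p R K k)) fun k => by
    simp only [bmComplex, relComplex, ChainComplex.of_d]
    exact ModuleCat.hom_ext (LinearMap.ext fun c => relBoundary_bmToRel p K c)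

/-- The complex of locally finite chains as a cone over the system of the relative complexes. -/
def bmCone (p : Perversity F) (R : Type v) [CommRing R] : Cone (relSystem p R) where
  pt := bmComplex p R
  π :=
    { app := fun K => bmToRelComplex p R K.unop
      naturality := fun L K f => by
        ext k c : 3
        exact (relMap_bmToRel p (leOfHom f.unop) c).symm }

/-- Limits of complexes can be tested in each degree, and limits of modules on underlying sets; what
remains is the unique lifting of compatible families. -/
theorem nonempty_isLimit_bmCone [LocallyCompactSpace X] (p : Perversity F) (R : Type v)
    [CommRing R] : Nonempty (IsLimit (bmCone p R)) := by
  refine ⟨HomologicalComplex.isLimitOfEval _ _ fun k => Classical.choice ?_⟩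
  refine Nonempty.map (fun h => isLimitOfReflects (forget (ModuleCat.{max u v} R)) h) ?_
  rw [Types.isLimit_iff]
  intro s hs
  obtain ⟨c, hc, huniq⟩ := existsUnique_bmToRel (p := p) (R := R) (k := k)
    (fun K => s (op K)) fun K L h => hs (homOfLE h).op
  exact ⟨c, fun K => hc K.unop, fun c' hc' => huniq c' fun K => hc' (op K)⟩

end Perv

end

theorem proposition3 {X : Type u} [TopologicalSpace X] [LocallyCompactSpace X]
    [MetrizableSpace X] [SeparableSpace X] {n : ℕ} (F : Perv.ClosedFiltration X n)
    (_hF : F.regularPart.Nonempty) (p : Perv.Perversity F)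
    (R : Type v) [CommRing R] [IsDomain R] [IsPrincipalIdealRing R] :
    ∃ e : Perv.bmComplex p R ≅ limit (Perv.relSystem p R),
      ∀ (K : Compacts X) (k : ℕ) (c : Perv.bmChains p R k),
        ∃ d : Perv.finChains p R k,
          (∀ σ : Perv.RegularSimplex F k,
            (Set.range σ.toMap ∩ K).Nonempty → d.1 σ = c.1 σ) ∧
          ((e.hom ≫ limit.π (Perv.relSystem p R) (op K)).f k).hom c =
            Perv.relClass (Perv.complCompact K) p R k d := by
  obtain ⟨hl⟩ := Perv.nonempty_isLimit_bmCone p R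
  refine ⟨hl.conePointUniqueUpToIso (limit.isLimit _), fun K k c => ?_⟩
  obtain ⟨d, hd⟩ := Perv.exists_finChains_agreeOn c K.isCompact
  refine ⟨d, hd, ?_⟩
  -- The comparison isomorphism followed by the projection at `K` is the leg of `bmCone` at `K`, so
  -- `d` represents the component there.
  have h := hl.conePointUniqueUpToIso_hom_comp (limit.isLimit (Perv.relSystem p R)) (op K)
  exact (congrArg (fun f : Perv.bmComplex p R ⟶ (Perv.relSystem p R).obj (op K) =>
    (f.f k).hom c) h).trans (Perv.bmToRel_eq_iff.2 hd)
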